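/- Let $n\ge 1$ be an integer, $\lambda\in(0,1)$, let $p\ge 1$ be a real number and let $q\in(1,\infty]$ be its Hölder conjugate, $1/p+1/q=1$ (for $p=1$ all powers with exponent $1/q=0$ are read as $1$). Let $K,L\subset\mathbb{R}^n$ be non-empty bounded sets, let $-1/n\le\alpha\le\infty$, and let $f,g,h:\mathbb{R}^n\to\mathbb{R}_{\ge 0}$. For $\mu\in[0,1]$ put $$t_\mu=(1-\lambda)^{1/p}(1-\mu)^{1/q},\qquad s_\mu=\lambda^{1/p}\mu^{1/q}.$$ Assume that $$h(t_\mu x+s_\mu y)\ \ge\ \bigl[t_\mu f(x)^{\alpha}+s_\mu g(y)^{\alpha}\bigr]^{1/\alpha}$$ for all $x\in K$, $y\in L$ with $f(x)g(y)>0$ and all $\mu\in[0,1]$. Here, for $\alpha=\infty$, the right-hand side is read as $\max\{f(x),g(y)\}$ if $t_\mu,s_\mu>0$, as $f(x)$ if $s_\mu=0$ and as $g(y)$ if $t_\mu=0$; for $\alpha=0$ the assumption is read as $h((1-\lambda)x+\lambda y)\ge f(x)^{1-\lambda}g(y)^{\lambda}$ for all $x\in K$, $y\in L$ with $f(x)g(y)>0$.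 For $a,b\ge 0$ and $\gamma\in[-\infty,\infty]$ define the $\gamma$-mean with weight $\lambda$ by $\mathcal{M}_\gamma^\lambda(a,b)=0$ if $ab=0$, and if $ab>0$ by $\mathcal{M}_\gamma^\lambda(a,b)=\bigl((1-\lambda)a^\gamma+\lambda b^\gamma\bigr)^{1/\gamma}$ for $\gamma\in\mathbb{R}\setminus\{0\}$, $\mathcal{M}_0^\lambda(a,b)=a^{1-\lambda}b^\lambda$, $\mathcal{M}_{\infty}^\lambda(a,b)=\max\{a,b\}$ and $\mathcal{M}_{-\infty}^\lambda(a,b)=\min\{a,b\}$. Let $$M_p=(1-\lambda)\cdot K+_p\lambda\cdot L=\bigl\{t_\mu x+s_\mu y:\ x\in K,\ y\in L,\ \mu\in[0,1]\bigr\}$$ and $h^{\diamond}(z)=\sup_{u\in(-1,1)^n}h(z+u)\in[0,\infty]$ for $z\in\mathbb{R}^n$. Then $$\sum_{z\in(M_p+(-1,1)^n)\cap\mathbb{Z}^n}h^{\diamond}(z)\ \ge\ \mathcal{M}_{\frac{p\alpha}{n\alpha+1}}^{\lambda}\Bigl(\ \sum_{x\in K\cap\mathbb{Z}^n}f(x),\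 \sum_{y\in L\cap\mathbb{Z}^n}g(y)\Bigr),$$ where $\frac{p\alpha}{n\alpha+1}$ is read as $-\infty$ for $\alpha=-1/n$ and as $p/n$ for $\alpha=\infty$. -/

import Mathlib

open Set
open scoped Pointwise ENNReal

noncomputable section

/-- The `α`-sum of two non-negative reals `a`, `b` with coefficients `t, s ≥ 0`, for `α ≠ 0`:
`(t a ^ α + s b ^ α) ^ (1 / α)` for real `α`, the maximum for `α = ∞`, the minimum for `α = -∞`,
and `0` as soon as `a * b = 0`.  For `α = ±∞` a term whose coefficient vanishes is dropped, as it
is in `(t a ^ α + s b ^ α) ^ (1 / α)` and in its limits.  The value at `α = 0` is never used. -/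
def alphaSum (α : EReal) (t s a b : ℝ) : ℝ :=
  if a * b = 0 then 0
  else if α = ⊤ then (if t = 0 then b else if s = 0 then a else max a b)
  else if α = ⊥ then (if t = 0 then b else if s = 0 then a else min a b)
  else (t * a ^ α.toReal + s * b ^ α.toReal) ^ (1 / α.toReal)

/-- The `α`-mean of two non-negative reals with weight `lam ∈ (0, 1)`. -/
def alphaMean (α : EReal) (lam a b : ℝ) : ℝ :=
  if α = 0 then a ^ (1 - lam) * b ^ lam else alphaSum α (1 - lam) lam a b

/-- The extended real number `p α / (n α + 1)`, read as its limit at the ends of the range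
`-1 / n ≤ α ≤ ∞`: it is `-∞` for `α = -1 / n` and `p / n` for `α = ∞`. -/
def bblExponent (n : ℕ) (p : ℝ) (α : EReal) : EReal :=
  if α = ⊤ then ((p / n : ℝ) : EReal)
  else if α = ((-1 / n : ℝ) : EReal) then ⊥
  else ((p * α.toReal / (n * α.toReal + 1) : ℝ) : EReal)

/-- `1 / q` for the Hölder conjugate `q` of the real number `p ≥ 1`, i.e. `1 / p + 1 / q = 1`.
For `p = 1` (`q = ∞`) it is `0`, and then `x ^ (1 / q) = 1` for all `x ≥ 0`, including `x = 0`. -/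
def invConj (p : ℝ) : ℝ := 1 - 1 / p

/-- The `p`-sum `K +_p L` of two arbitrary subsets of `ℝⁿ`. -/
def pSum {n : ℕ} (p : ℝ) (K L : Set (Fin n → ℝ)) : Set (Fin n → ℝ) :=
  {z | ∃ x ∈ K, ∃ y ∈ L, ∃ μ ∈ Icc (0 : ℝ) 1,
    z = (1 - μ) ^ invConj p • x + μ ^ invConj p • y}

/-- The `p`-scalar multiple `c · K = c ^ (1 / p) K`. -/
def pSmul {n : ℕ} (p c : ℝ) (K : Set (Fin n → ℝ)) : Set (Fin n → ℝ) :=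
  c ^ (1 / p) • K

/-- The open cube `(-1, 1)ⁿ`. -/
def openCube (n : ℕ) : Set (Fin n → ℝ) := univ.pi fun _ => Ioo (-1) 1

/-- The integer lattice `ℤⁿ` as a subset of `ℝⁿ`. -/
def intLattice (n : ℕ) : Set (Fin n → ℝ) := range fun (z : Fin n → ℤ) (i : Fin n) => (z i : ℝ)

/-- `φ^♦ z`, the supremum of `φ` over `z + (-1, 1)ⁿ`, with values in `[0, ∞]`. -/
def diamond {n : ℕ} (φ : (Fin n → ℝ) → ℝ) (z : Fin n → ℝ) : ℝ≥0∞ :=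
  ⨆ u ∈ openCube n, ENNReal.ofReal (φ (z + u))

/-- A bounded set contains only finitely many integer points, so that sums over its integer points
are finite sums. -/
theorem finite_inter_intLattice {n : ℕ} {K : Set (Fin n → ℝ)} (hK : Bornology.IsBounded K) :
    (K ∩ intLattice n).Finite := by
  obtain ⟨R, hR⟩ := hK.exists_norm_le
  refine ((Set.Finite.pi' fun _ : Fin n => Set.finite_Icc (-⌈R⌉) ⌈R⌉).image
    fun (z : Fin n → ℤ) (i : Fin n) => (z i : ℝ)).subset ?_
  rintro _ ⟨hx, z, rfl⟩
  refine ⟨z, fun i => ?_, rfl⟩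
  have h1 : |(z i : ℝ)| ≤ R := (norm_le_pi_norm (fun i => (z i : ℝ)) i).trans (hR _ hx)
  have h2 := abs_le.1 (h1.trans (Int.le_ceil R))
  exact ⟨by exact_mod_cast h2.1, by exact_mod_cast h2.2⟩

end

/-!
The discrete inequality is deduced from a continuous one.  Let `F` take the value `f z` on each cube
`z + [0, 1)ⁿ` with `z ∈ K ∩ ℤⁿ` and vanish elsewhere, define `G` from `g` and `L` in the same way,
and let `H` take the value `diamond h z` on the cubes of the points `z` summed over on the right.
The three integrals are the three sums.  For `μ ∈ (0, 1)` the coefficients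
`t = (1 - lam) ^ (1 / p) * (1 - μ) ^ (1 / q)` and `s = lam ^ (1 / p) * μ ^ (1 / q)` satisfy
`t + s ≤ 1`, so the integer part of `t x + s y` differs from `t ⌊x⌋ + s ⌊y⌋` by a point of the cube
`(-1, 1)ⁿ`; hence `H (t x + s y)` is at least the `α`-sum of `F x` and `G y` with coefficients
`t, s` (`ofReal_mean_le_tsum_diamond`).

For fixed `t, s`, which need not add up to `1`, the continuous statement is a
Borell–Brascamp–Lieb inequality, proved by induction on the dimension
(`ofReal_mean_le_lintegral`).  It is stated for a chain `Φ 0, …, Φ n` of abstract means with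
`Φ (k + 1) (a c) (b d) ≤ Φ k a b * (t c + s d)` (`MeanStep`); each integration over one coordinate
advances the chain by one.  The one-dimensional step (`MeanStep.ofReal_le_lintegral`) divides both
functions by their suprema and integrates the one-dimensional Brunn–Minkowski inequality over the
superlevel sets.  The chain starting from the `α`-sum consists of the power means of exponents
`1 / (1 / α + k)`, with the maximum at the start for `α = ∞` and the minimum at the end for
`α = -1 / n`; for `α = 0` it is constantly the geometric mean.  For the power means `MeanStep` is
Hölder's inequality for two terms.

With `γ = α / (n α + 1)` the outcome is the bound `(t A ^ γ + s B ^ γ) ^ (1 / γ)` for the sums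
`A, B` of `f` and `g`, and the equality case of Hölder's inequality provides a `μ` for which this
equals the mean with exponent `p γ` (`exists_powMean_eq`).  For `α = -1 / n` every `μ` gives
`min A B`, and for `α = 0` one takes `μ = lam`, where `t = 1 - lam` and `s = lam`.
-/

open MeasureTheory

/-! ### The one-dimensional inequality -/

theorem volume_add_volume_le_of_isCompact {A B S : Set ℝ} (hA : IsCompact A) (hB : IsCompact B)
    (hA0 : A.Nonempty) (hB0 : B.Nonempty) (hS : A + B ⊆ S) :
    volume A + volume B ≤ volume S := by
  obtain ⟨a, haA, ha⟩ := hA.exists_isGreatest hA0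
  obtain ⟨b, hbB, hb⟩ := hB.exists_isLeast hB0
  -- The translates `b + A` and `a + B` both lie in `A + B` and meet only in the point `a + b`.
  have h1 : volume ((b +ᵥ A) ∪ (a +ᵥ B)) = volume (b +ᵥ A) + volume (a +ᵥ B) := by
    apply measure_union₀ (hB.vadd a).measurableSet.nullMeasurableSet
    refine measure_mono_null (t := {a + b}) ?_ (by simp)
    rintro _ ⟨⟨x, hx, rfl⟩, y, hy, hxy⟩
    have h1 := ha hx
    have h2 := hb hy
    simp only [vadd_eq_add] at hxy ⊢
    simp only [mem_singleton_iff]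
    linarith
  have h2 : (b +ᵥ A) ∪ (a +ᵥ B) ⊆ S := by
    refine subset_trans ?_ hS
    rintro _ (⟨x, hx, rfl⟩ | ⟨x, hx, rfl⟩)
    · exact ⟨x, hx, b, hbB, by simp [add_comm]⟩
    · exact ⟨a, haA, x, hx, by simp⟩
  calc volume A + volume B = volume ((b +ᵥ A) ∪ (a +ᵥ B)) := by
        rw [h1, measure_vadd, measure_vadd]
    _ ≤ volume S := measure_mono h2

/-- The one-dimensional Brunn–Minkowski inequality. -/
theorem volume_add_volume_le {A B S : Set ℝ} (hA : MeasurableSet A) (hB : MeasurableSet B)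
    (hA0 : A.Nonempty) (hB0 : B.Nonempty) (hS : A + B ⊆ S) :
    volume A + volume B ≤ volume S := by
  obtain ⟨a, ha⟩ := hA0
  obtain ⟨b, hb⟩ := hB0
  rw [hA.measure_eq_iSup_isCompact, hB.measure_eq_iSup_isCompact]
  simp only [iSup_and']
  refine ENNReal.biSup_add_biSup_le' ⟨∅, by simp⟩ ⟨∅, by simp⟩ ?_
  rintro C ⟨hCA, hC⟩ D ⟨hDB, hD⟩
  refine le_trans (add_le_add (measure_mono (subset_insert a C)) (measure_mono (subset_insert b D)))
    (volume_add_volume_le_of_isCompact (hC.insert a) (hD.insert b) ⟨a, by simp⟩ ⟨b, by simp⟩ ?_)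
  exact (add_subset_add (insert_subset ha hCA) (insert_subset hb hDB)).trans hS

/-- The one-dimensional Brunn–Minkowski inequality with arbitrary positive weights. -/
theorem mul_volume_add_mul_volume_le {A B S : Set ℝ} (hA : MeasurableSet A) (hB : MeasurableSet B)
    (hA0 : A.Nonempty) (hB0 : B.Nonempty) {t s : ℝ} (ht : 0 < t) (hs : 0 < s)
    (hS : ∀ a ∈ A, ∀ b ∈ B, t * a + s * b ∈ S) :
    ENNReal.ofReal t * volume A + ENNReal.ofReal s * volume B ≤ volume S := by
  have h := volume_add_volume_le (S := S) (hA.const_smul₀ t) (hB.const_smul₀ s)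
    (hA0.smul_set (a := t)) (hB0.smul_set (a := s)) (by
      rintro _ ⟨_, ⟨x, hx, rfl⟩, _, ⟨y, hy, rfl⟩, rfl⟩
      exact hS x hx y hy)
  simpa [Measure.addHaar_smul, abs_of_pos ht, abs_of_pos hs] using h

theorem lintegral_ofReal_eq_setLIntegral_Ioo {f : ℝ → ℝ} (hf : Measurable f) (hf0 : ∀ x, 0 ≤ f x)
    (hf1 : ∀ x, f x ≤ 1) :
    ∫⁻ x, ENNReal.ofReal (f x) = ∫⁻ r in Ioo (0 : ℝ) 1, volume {x | r ≤ f x} := by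
  have h0 : ∫⁻ r in Ioi (1 : ℝ), volume {x | r ≤ f x} = 0 := by
    rw [setLIntegral_congr_fun (g := fun _ => 0) measurableSet_Ioi, lintegral_zero]
    intro r hr
    have : {x | r ≤ f x} = ∅ := by
      ext x
      simpa using (hf1 x).trans_lt hr
    simp [this]
  rw [lintegral_eq_lintegral_meas_le _ (ae_of_all _ hf0) hf.aemeasurable,
    ← Ioc_union_Ioi_eq_Ioi (zero_le_one (α := ℝ)),
    lintegral_union measurableSet_Ioi (disjoint_left.2 fun x h1 h2 => not_lt.2 h1.2 h2),
    setLIntegral_congr Ioo_ae_eq_Ioc.symm, h0, add_zero]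

/-- The one-dimensional case for functions with supremum `1`: the superlevel set of `H` at a height
`r < 1` contains the weighted sum of those of `f` and `g`, both of which are non-empty, and the
one-dimensional Brunn–Minkowski inequality is integrated over `r`. -/
theorem lintegral_add_lintegral_le_of_sup_eq_one {f g : ℝ → ℝ} {H : ℝ → ℝ≥0∞} (hf : Measurable f)
    (hg : Measurable g) (hH : Measurable H) (hf0 : ∀ x, 0 ≤ f x) (hg0 : ∀ x, 0 ≤ g x)
    (hf1 : ∀ x, f x ≤ 1) (hg1 : ∀ x, g x ≤ 1) (hf2 : ∀ r < 1, ∃ x, r ≤ f x)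
    (hg2 : ∀ r < 1, ∃ x, r ≤ g x) {t s : ℝ} (ht : 0 < t) (hs : 0 < s)
    (hyp : ∀ r ∈ Ioo (0 : ℝ) 1, ∀ x y, r ≤ f x → r ≤ g y → ENNReal.ofReal r ≤ H (t * x + s * y)) :
    ENNReal.ofReal t * (∫⁻ x, ENNReal.ofReal (f x)) +
      ENNReal.ofReal s * (∫⁻ x, ENNReal.ofReal (g x)) ≤ ∫⁻ x, H x := by
  have hmeas (φ : ℝ → ℝ) : Measurable fun r => volume {x | r ≤ φ x} :=
    Antitone.measurable fun r r' hr => measure_mono fun x hx => hr.trans hx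
  have hlt (x : ℝ) : min (H x) 1 ≠ ∞ := ((min_le_right _ _).trans_lt ENNReal.one_lt_top).ne
  calc _ = ∫⁻ r in Ioo (0 : ℝ) 1, (ENNReal.ofReal t * volume {x | r ≤ f x} +
        ENNReal.ofReal s * volume {x | r ≤ g x}) := by
        rw [lintegral_ofReal_eq_setLIntegral_Ioo hf hf0 hf1,
          lintegral_ofReal_eq_setLIntegral_Ioo hg hg0 hg1,
          lintegral_add_left ((hmeas f).const_mul _), lintegral_const_mul _ (hmeas f),
          lintegral_const_mul _ (hmeas g)]
    _ ≤ ∫⁻ r in Ioo (0 : ℝ) 1, volume {x | r ≤ (min (H x) 1).toReal} := by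
        refine setLIntegral_mono (hmeas _) fun r hr => ?_
        refine mul_volume_add_mul_volume_le (measurableSet_le measurable_const hf)
          (measurableSet_le measurable_const hg) (hf2 r hr.2) (hg2 r hr.2) ht hs ?_
        intro x hx y hy
        rw [mem_ofPred_eq, ← ENNReal.ofReal_le_iff_le_toReal (hlt _)]
        exact le_min (hyp r hr x y hx hy) (ENNReal.ofReal_le_one.2 hr.2.le)
    _ = ∫⁻ x, ENNReal.ofReal ((min (H x) 1).toReal) := by
        rw [lintegral_ofReal_eq_setLIntegral_Ioo (hH.min measurable_const).ennreal_toReal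
          (fun x => ENNReal.toReal_nonneg)]
        exact fun x => ENNReal.toReal_le_of_le_ofReal zero_le_one (by simp)
    _ ≤ ∫⁻ x, H x := by
        refine lintegral_mono fun x => ?_
        rw [ENNReal.ofReal_toReal (hlt x)]
        exact min_le_left _ _

/-- A mean of two positive reals: positive, monotone, and (super-)homogeneous of degree one. -/
structure IsMean (φ : ℝ → ℝ → ℝ) : Prop where
  pos : ∀ a b, 0 < a → 0 < b → 0 < φ a b
  mono : ∀ a b a' b', 0 < a → 0 < b → a ≤ a' → b ≤ b' → φ a b ≤ φ a' b'
  mul_le : ∀ r a b, 0 < r → 0 < a → 0 < b → r * φ a b ≤ φ (r * a) (r * b)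

/-- `ψ (a c) (b d) ≤ φ a b (t c + s d)`: the inequality that lets `ψ` bound the integral over one
more real variable when `φ` bounds the integrand. -/
def MeanStep (t s : ℝ) (φ ψ : ℝ → ℝ → ℝ) : Prop :=
  ∀ a b c d, 0 < a → 0 < b → 0 < c → 0 < d → ψ (a * c) (b * d) ≤ φ a b * (t * c + s * d)

/-- The one-dimensional Borell–Brascamp–Lieb inequality for abstract means. -/
theorem MeanStep.ofReal_le_lintegral {t s : ℝ} (ht : 0 < t) (hs : 0 < s) {φ ψ : ℝ → ℝ → ℝ}
    (hφ : IsMean φ) (hφψ : MeanStep t s φ ψ) {f g : ℝ → ℝ} {H : ℝ → ℝ≥0∞} (hf : Measurable f)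
    (hg : Measurable g) (hH : Measurable H) (hf0 : ∀ x, 0 ≤ f x) (hg0 : ∀ x, 0 ≤ g x)
    (hfb : BddAbove (range f)) (hgb : BddAbove (range g))
    (hyp : ∀ x y, 0 < f x → 0 < g y → ENNReal.ofReal (φ (f x) (g y)) ≤ H (t * x + s * y))
    {A B : ℝ} (hA : 0 < A) (hB : 0 < B) (hfA : ∫⁻ x, ENNReal.ofReal (f x) = ENNReal.ofReal A)
    (hgB : ∫⁻ x, ENNReal.ofReal (g x) = ENNReal.ofReal B) :
    ENNReal.ofReal (ψ A B) ≤ ∫⁻ x, H x := by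
  have key (f : ℝ → ℝ) (hf0 : ∀ x, 0 ≤ f x) (hfb : BddAbove (range f)) (A : ℝ) (hA : 0 < A)
      (hfA : ∫⁻ x, ENNReal.ofReal (f x) = ENNReal.ofReal A) :
      ∃ m, 0 < m ∧ (∀ x, f x ≤ m) ∧ (∀ r < 1, ∃ x, r ≤ m⁻¹ * f x) ∧
        ∫⁻ x, ENNReal.ofReal (m⁻¹ * f x) = ENNReal.ofReal (m⁻¹ * A) := by
    have hle (x : ℝ) : f x ≤ sSup (range f) := le_csSup hfb (mem_range_self x)
    have hm : 0 < sSup (range f) := by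
      by_contra hm
      have h0 (x : ℝ) : f x = 0 := le_antisymm ((hle x).trans (not_lt.1 hm)) (hf0 x)
      simp only [h0, ENNReal.ofReal_zero, lintegral_zero] at hfA
      exact (ENNReal.ofReal_pos.2 hA).ne hfA
    refine ⟨sSup (range f), hm, hle, fun r hr => ?_, ?_⟩
    · obtain ⟨_, ⟨x, rfl⟩, hx⟩ := exists_lt_of_lt_csSup (range_nonempty f)
        (mul_lt_of_lt_one_right hm hr)
      exact ⟨x, by rw [le_inv_mul_iff₀ hm]; exact hx.le⟩
    · have hm' := inv_nonneg.2 hm.le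
      simp only [ENNReal.ofReal_mul hm']
      rw [lintegral_const_mul' _ _ ENNReal.ofReal_ne_top, hfA]
  obtain ⟨m, hm, hfm, hfm', hfI⟩ := key f hf0 hfb A hA hfA
  obtain ⟨k, hk, hgk, hgk', hgI⟩ := key g hg0 hgb B hB hgB
  have hM := hφ.pos m k hm hk
  have hmA : 0 < m⁻¹ * A := by positivity
  have hkB : 0 < k⁻¹ * B := by positivity
  have main := lintegral_add_lintegral_le_of_sup_eq_one (f := fun x => m⁻¹ * f x)
    (g := fun x => k⁻¹ * g x) (H := fun x => (ENNReal.ofReal (φ m k))⁻¹ * H x)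
    (hf.const_mul _) (hg.const_mul _) (hH.const_mul _)
    (fun x => mul_nonneg (inv_nonneg.2 hm.le) (hf0 x))
    (fun x => mul_nonneg (inv_nonneg.2 hk.le) (hg0 x))
    (fun x => by rw [inv_mul_le_iff₀ hm]; simpa using hfm x)
    (fun x => by rw [inv_mul_le_iff₀ hk]; simpa using hgk x) hfm' hgk' ht hs (by
      intro r hr x y hx hy
      rw [le_inv_mul_iff₀ hm] at hx
      rw [le_inv_mul_iff₀ hk] at hy
      have hrm : 0 < m * r := mul_pos hm hr.1
      have hrk : 0 < k * r := mul_pos hk hr.1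
      rw [mul_comm, ← div_eq_mul_inv, ENNReal.le_div_iff_mul_le
        (Or.inl (ENNReal.ofReal_pos.2 hM).ne') (Or.inl ENNReal.ofReal_ne_top),
        ← ENNReal.ofReal_mul hr.1.le]
      refine le_trans (ENNReal.ofReal_le_ofReal ?_)
        (hyp x y (hrm.trans_le hx) (hrk.trans_le hy))
      refine (hφ.mul_le r m k hr.1 hm hk).trans ?_
      rw [mul_comm r, mul_comm r]
      exact hφ.mono _ _ _ _ hrm hrk hx hy)
  rw [hfI, hgI, lintegral_const_mul _ hH, ← ENNReal.ofReal_mul ht.le, ← ENNReal.ofReal_mul hs.le,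
    ← ENNReal.ofReal_add (by positivity) (by positivity), mul_comm (ENNReal.ofReal _)⁻¹,
    ← div_eq_mul_inv, ENNReal.le_div_iff_mul_le (Or.inl (ENNReal.ofReal_pos.2 hM).ne')
    (Or.inl ENNReal.ofReal_ne_top),
    ← ENNReal.ofReal_mul (by positivity)] at main
  refine le_trans (ENNReal.ofReal_le_ofReal ?_) main
  have h := hφψ m k _ _ hm hk hmA hkB
  rw [mul_inv_cancel_left₀ hm.ne', mul_inv_cancel_left₀ hk.ne'] at h
  linarith

/-! ### Induction on the dimension -/

/-- A function on `ℝⁿ` that is bounded and vanishes outside some box `[-R, R]ⁿ`. -/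
def IsBoundedOnBox {n : ℕ} (F : (Fin n → ℝ) → ℝ≥0∞) : Prop :=
  ∃ C : ℝ≥0∞, C ≠ ∞ ∧ ∃ R : ℝ, (∀ x, F x ≤ C) ∧ ∀ x, F x ≠ 0 → ∀ i, x i ∈ Icc (-R) R

theorem lintegral_le_mul_volume_box {n : ℕ} {F : (Fin n → ℝ) → ℝ≥0∞} {C : ℝ≥0∞} {R : ℝ}
    (hC : ∀ x, F x ≤ C) (hR : ∀ x, F x ≠ 0 → ∀ i, x i ∈ Icc (-R) R) :
    ∫⁻ x, F x ≤ C * volume (univ.pi fun _ : Fin n => Icc (-R) R) := by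
  calc ∫⁻ x, F x ≤ ∫⁻ x, (univ.pi fun _ : Fin n => Icc (-R) R).indicator (fun _ => C) x := by
        refine lintegral_mono fun x => ?_
        by_cases h : F x = 0
        · simp [h]
        · rw [indicator_of_mem (mem_univ_pi.2 (hR x h))]
          exact hC x
    _ = _ := lintegral_indicator_const (.univ_pi fun _ => measurableSet_Icc) _

theorem volume_box_ne_top (n : ℕ) (R : ℝ) :
    volume (univ.pi fun _ : Fin n => Icc (-R) R) ≠ ∞ :=
  (isCompact_univ_pi fun _ => isCompact_Icc).measure_ne_top

theorem IsBoundedOnBox.lintegral_ne_top {n : ℕ} {F : (Fin n → ℝ) → ℝ≥0∞}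
    (hF : IsBoundedOnBox F) : ∫⁻ x, F x ≠ ∞ := by
  obtain ⟨C, hC, R, h1, h2⟩ := hF
  exact ((lintegral_le_mul_volume_box h1 h2).trans_lt
    (ENNReal.mul_lt_top hC.lt_top (volume_box_ne_top n R).lt_top)).ne

/-- The integral of `F` over the slice where the first coordinate is `x`. -/
noncomputable def sliceIntegral {n : ℕ} (F : (Fin (n + 1) → ℝ) → ℝ≥0∞) (x : ℝ) : ℝ≥0∞ :=
  ∫⁻ y : Fin n → ℝ, F (Fin.cons x y)

theorem measurable_cons (n : ℕ) :
    Measurable fun p : ℝ × (Fin n → ℝ) => (Fin.cons p.1 p.2 : Fin (n + 1) → ℝ) := by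
  simpa [MeasurableEquiv.piFinSuccAbove, Fin.insertNthEquiv] using
    (MeasurableEquiv.piFinSuccAbove (fun _ : Fin (n + 1) => ℝ) 0).symm.measurable

theorem measurable_sliceIntegral {n : ℕ} {F : (Fin (n + 1) → ℝ) → ℝ≥0∞} (hF : Measurable F) :
    Measurable (sliceIntegral F) :=
  (hF.comp (measurable_cons n)).lintegral_prod_right'

theorem lintegral_sliceIntegral {n : ℕ} {F : (Fin (n + 1) → ℝ) → ℝ≥0∞} (hF : Measurable F) :
    ∫⁻ x, sliceIntegral F x = ∫⁻ x, F x := by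
  rw [← ((volume_preserving_piFinSuccAbove (fun _ : Fin (n + 1) => ℝ) 0).symm).lintegral_comp hF,
    Measure.volume_eq_prod, lintegral_prod _ (by
      exact (hF.comp (MeasurableEquiv.measurable _)).aemeasurable)]
  simp [sliceIntegral, MeasurableEquiv.piFinSuccAbove, Fin.insertNthEquiv]

theorem IsBoundedOnBox.cons {n : ℕ} {F : (Fin (n + 1) → ℝ) → ℝ≥0∞} (hF : IsBoundedOnBox F)
    (x : ℝ) : IsBoundedOnBox fun y : Fin n → ℝ => F (Fin.cons x y) := by
  obtain ⟨C, hC, R, h1, h2⟩ := hF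
  exact ⟨C, hC, R, fun y => h1 _, fun y hy i => by simpa using h2 _ hy i.succ⟩

theorem IsBoundedOnBox.bddAbove_sliceIntegral {n : ℕ} {F : (Fin (n + 1) → ℝ) → ℝ≥0∞}
    (hF : IsBoundedOnBox F) : BddAbove (range fun x => (sliceIntegral F x).toReal) := by
  obtain ⟨C, hC, R, h1, h2⟩ := hF
  refine ⟨(C * volume (univ.pi fun _ : Fin n => Icc (-R) R)).toReal, ?_⟩
  rintro _ ⟨x, rfl⟩
  exact ENNReal.toReal_mono (ENNReal.mul_ne_top hC (volume_box_ne_top n R))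
    (lintegral_le_mul_volume_box (fun y => h1 _) fun y hy i => by simpa using h2 _ hy i.succ)

/-- The Borell–Brascamp–Lieb inequality on `ℝⁿ` for a chain `Φ 0, …, Φ n` of abstract means, by
induction on the dimension: the integrals over the slices satisfy the hypothesis with the mean
`Φ n`, and one more integration leads to `Φ (n + 1)`. -/
theorem ofReal_mean_le_lintegral {t s : ℝ} (ht : 0 < t) (hs : 0 < s) {Φ : ℕ → ℝ → ℝ → ℝ} {n : ℕ}
    (hΦ : ∀ k < n, IsMean (Φ k)) (hstep : ∀ k < n, MeanStep t s (Φ k) (Φ (k + 1)))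
    {F G H : (Fin n → ℝ) → ℝ≥0∞} (hF : Measurable F) (hG : Measurable G) (hH : Measurable H)
    (hFb : IsBoundedOnBox F) (hGb : IsBoundedOnBox G)
    (hyp : ∀ x y, F x ≠ 0 → G y ≠ 0 →
      ENNReal.ofReal (Φ 0 (F x).toReal (G y).toReal) ≤ H (t • x + s • y))
    (hF0 : ∫⁻ x, F x ≠ 0) (hG0 : ∫⁻ x, G x ≠ 0) :
    ENNReal.ofReal (Φ n (∫⁻ x, F x).toReal (∫⁻ x, G x).toReal) ≤ ∫⁻ x, H x := by
  induction n with
  | zero =>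
    simp only [lintegral_unique, volume_pi, Measure.pi_empty_univ, mul_one] at hF0 hG0 ⊢
    convert! hyp _ _ hF0 hG0
  | succ n ih =>
    have hfin (x : ℝ) : sliceIntegral F x ≠ ∞ := (hFb.cons x).lintegral_ne_top
    have hgin (x : ℝ) : sliceIntegral G x ≠ ∞ := (hGb.cons x).lintegral_ne_top
    rw [← lintegral_sliceIntegral hH]
    refine (hstep n n.lt_succ_self).ofReal_le_lintegral ht hs (hΦ n n.lt_succ_self)
      (measurable_sliceIntegral hF).ennreal_toReal (measurable_sliceIntegral hG).ennreal_toReal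
      (measurable_sliceIntegral hH) (fun x => ENNReal.toReal_nonneg)
      (fun x => ENNReal.toReal_nonneg) hFb.bddAbove_sliceIntegral hGb.bddAbove_sliceIntegral ?_
      (ENNReal.toReal_pos hF0 hFb.lintegral_ne_top) (ENNReal.toReal_pos hG0 hGb.lintegral_ne_top)
      ?_ ?_
    · intro x y hx hy
      refine ih (fun k hk => hΦ k (hk.trans n.lt_succ_self))
        (fun k hk => hstep k (hk.trans n.lt_succ_self))
        (hF.comp ((measurable_cons n).comp measurable_prodMk_left))
        (hG.comp ((measurable_cons n).comp measurable_prodMk_left))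
        (H := fun z => H (Fin.cons (t * x + s * y) z))
        (hH.comp ((measurable_cons n).comp measurable_prodMk_left)) (hFb.cons x) (hGb.cons y)
        (fun u v hu hv => ?_) (ENNReal.toReal_pos_iff.1 hx).1.ne' (ENNReal.toReal_pos_iff.1 hy).1.ne'
      convert hyp _ _ hu hv using 2
      ext i
      refine Fin.cases ?_ (fun i => ?_) i <;> simp
    · simp_rw [ENNReal.ofReal_toReal (hfin _), ENNReal.ofReal_toReal hFb.lintegral_ne_top]
      exact lintegral_sliceIntegral hF
    · simp_rw [ENNReal.ofReal_toReal (hgin _), ENNReal.ofReal_toReal hGb.lintegral_ne_top]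
      exact lintegral_sliceIntegral hG

/-! ### Means and Hölder's inequality -/

/-- Hölder's inequality for two terms, with weights `t, s`. -/
theorem weighted_holder_two {t s x y c d θ : ℝ} (ht : 0 < t) (hs : 0 < s) (hx : 0 < x) (hy : 0 < y)
    (hc : 0 < c) (hd : 0 < d) (h0 : 0 ≤ θ) (h1 : θ ≤ 1) :
    t * (x ^ θ * c ^ (1 - θ)) + s * (y ^ θ * d ^ (1 - θ)) ≤
      (t * x + s * y) ^ θ * (t * c + s * d) ^ (1 - θ) := by
  set X := t * x + s * y
  set C := t * c + s * d
  have hX : 0 < X := by positivity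
  have hC : 0 < C := by positivity
  have key (u v : ℝ) (hu : 0 < u) (hv : 0 < v) :
      u ^ θ * v ^ (1 - θ) ≤ X ^ θ * C ^ (1 - θ) * (θ * (u / X) + (1 - θ) * (v / C)) := by
    have h := Real.geom_mean_le_arith_mean2_weighted h0 (sub_nonneg.2 h1) (div_pos hu hX).le
      (div_pos hv hC).le (by ring)
    rw [Real.div_rpow hu.le hX.le, Real.div_rpow hv.le hC.le, div_mul_div_comm,
      div_le_iff₀ (by positivity)] at h
    linarith
  have hsum : t * (θ * (x / X) + (1 - θ) * (c / C)) + s * (θ * (y / X) + (1 - θ) * (d / C)) = 1 := by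
    have e1 : (t * x + s * y) / X = 1 := div_self hX.ne'
    have e2 : (t * c + s * d) / C = 1 := div_self hC.ne'
    linear_combination θ * e1 + (1 - θ) * e2
  calc _ ≤ t * (X ^ θ * C ^ (1 - θ) * (θ * (x / X) + (1 - θ) * (c / C))) +
        s * (X ^ θ * C ^ (1 - θ) * (θ * (y / X) + (1 - θ) * (d / C))) := by
        exact add_le_add (mul_le_mul_of_nonneg_left (key x c hx hc) ht.le)
          (mul_le_mul_of_nonneg_left (key y d hy hd) hs.le)
    _ = X ^ θ * C ^ (1 - θ) := by linear_combination (X ^ θ * C ^ (1 - θ)) * hsum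

/-- The mean `(t a ^ (1 / κ) + s b ^ (1 / κ)) ^ κ`.  The exponent is written as `1 / κ` because
integrating over one more real variable replaces `κ` by `κ + 1`. -/
noncomputable def powMean (t s κ a b : ℝ) : ℝ := (t * a ^ (1 / κ) + s * b ^ (1 / κ)) ^ κ

/-- The geometric mean `a ^ t * b ^ s`. -/
noncomputable def geomMean (t s a b : ℝ) : ℝ := a ^ t * b ^ s

theorem isMean_powMean {t s κ : ℝ} (ht : 0 < t) (hs : 0 < s) (hκ : κ ≠ 0) :
    IsMean (powMean t s κ) where
  pos a b ha hb := by unfold powMean; positivity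
  mono a b a' b' ha hb haa hbb := by
    unfold powMean
    have ha' := ha.trans_le haa
    have hb' := hb.trans_le hbb
    rcases hκ.lt_or_gt with h | h
    · have h' : 1 / κ ≤ 0 := (one_div_neg.2 h).le
      refine Real.rpow_le_rpow_of_nonpos (by positivity) ?_ h.le
      gcongr ?_ * ?_ + ?_ * ?_
      · exact Real.rpow_le_rpow_of_nonpos ha haa h'
      · exact Real.rpow_le_rpow_of_nonpos hb hbb h'
    · gcongr
  mul_le r a b hr ha hb := by
    unfold powMean
    rw [Real.mul_rpow hr.le ha.le, Real.mul_rpow hr.le hb.le]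
    have : t * (r ^ (1 / κ) * a ^ (1 / κ)) + s * (r ^ (1 / κ) * b ^ (1 / κ)) =
      r ^ (1 / κ) * (t * a ^ (1 / κ) + s * b ^ (1 / κ)) := by ring
    rw [this, Real.mul_rpow (by positivity) (by positivity), ← Real.rpow_mul hr.le,
      one_div_mul_cancel hκ, Real.rpow_one]

theorem isMean_max : IsMean max where
  pos _ _ ha _ := lt_max_of_lt_left ha
  mono _ _ _ _ _ _ ha hb := max_le_max ha hb
  mul_le _ _ _ hr _ _ := (mul_max_of_nonneg _ _ hr.le).le

theorem isMean_geomMean {t s : ℝ} (ht : 0 < t) (hs : 0 < s) (hts : t + s = 1) :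
    IsMean (geomMean t s) where
  pos a b ha hb := by unfold geomMean; positivity
  mono a b a' b' ha hb haa hbb := by
    have := ha.trans_le haa
    unfold geomMean
    gcongr
  mul_le r a b hr ha hb := by
    unfold geomMean
    rw [Real.mul_rpow hr.le ha.le, Real.mul_rpow hr.le hb.le, mul_mul_mul_comm,
      ← Real.rpow_add hr, hts, Real.rpow_one]

theorem meanStep_geomMean {t s : ℝ} (ht : 0 < t) (hs : 0 < s) (hts : t + s = 1) :
    MeanStep t s (geomMean t s) (geomMean t s) := by
  intro a b c d ha hb hc hd
  unfold geomMean
  rw [Real.mul_rpow ha.le hc.le, Real.mul_rpow hb.le hd.le, mul_mul_mul_comm]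
  gcongr
  exact Real.geom_mean_le_arith_mean2_weighted ht.le hs.le hc.le hd.le hts

theorem meanStep_max {t s : ℝ} (ht : 0 < t) (hs : 0 < s) : MeanStep t s max (powMean t s 1) := by
  intro a b c d ha hb hc hd
  simp only [powMean, div_one, Real.rpow_one]
  nlinarith [mul_le_mul_of_nonneg_left (le_max_left a b) (mul_pos ht hc).le,
    mul_le_mul_of_nonneg_left (le_max_right a b) (mul_pos hs hd).le]

theorem meanStep_min {t s : ℝ} (ht : 0 < t) (hs : 0 < s) :
    MeanStep t s (powMean t s (-1)) min := by
  intro a b c d ha hb hc hd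
  simp only [powMean, div_neg, div_one, Real.rpow_neg_one]
  rw [le_inv_mul_iff₀ (by positivity), add_mul]
  gcongr ?_ + ?_
  · calc t * a⁻¹ * min (a * c) (b * d) ≤ t * a⁻¹ * (a * c) := by gcongr; exact min_le_left _ _
      _ = t * c := by field_simp
  · calc s * b⁻¹ * min (a * c) (b * d) ≤ s * b⁻¹ * (b * d) := by gcongr; exact min_le_right _ _
      _ = s * d := by field_simp

theorem meanStep_powMean_of_pos {t s κ : ℝ} (ht : 0 < t) (hs : 0 < s) (hκ : 0 < κ) :
    MeanStep t s (powMean t s κ) (powMean t s (κ + 1)) := by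
  intro a b c d ha hb hc hd
  have h1 : 0 < κ + 1 := by positivity
  have hθ : κ / (κ + 1) ≤ 1 := (div_le_one h1).2 (by linarith)
  have e1 : 1 - κ / (κ + 1) = 1 / (κ + 1) := by field_simp; ring
  have key := weighted_holder_two ht hs (Real.rpow_pos_of_pos ha (1 / κ))
    (Real.rpow_pos_of_pos hb (1 / κ)) hc hd (by positivity) hθ
  have e2 (u : ℝ) (hu : 0 < u) : (u ^ (1 / κ)) ^ (κ / (κ + 1)) = u ^ (1 / (κ + 1)) := by
    rw [← Real.rpow_mul hu.le]; congr 1; field_simp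
  rw [e1, e2 a ha, e2 b hb, ← Real.mul_rpow ha.le hc.le, ← Real.mul_rpow hb.le hd.le] at key
  have h := Real.rpow_le_rpow (by positivity) key h1.le
  rwa [Real.mul_rpow (x := _ ^ _) (by positivity) (by positivity),
    ← Real.rpow_mul (by positivity), ← Real.rpow_mul (by positivity), one_div_mul_cancel h1.ne',
    Real.rpow_one, div_mul_cancel₀ _ h1.ne'] at h

theorem meanStep_powMean_of_lt_neg_one {t s κ : ℝ} (ht : 0 < t) (hs : 0 < s) (hκ : κ < -1) :
    MeanStep t s (powMean t s κ) (powMean t s (κ + 1)) := by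
  intro a b c d ha hb hc hd
  unfold powMean
  have h1 : κ < 0 := by linarith
  have h2 : κ + 1 < 0 := by linarith
  set P := t * a ^ (1 / κ) + s * b ^ (1 / κ) with hP
  set Q := t * (a * c) ^ (1 / (κ + 1)) + s * (b * d) ^ (1 / (κ + 1)) with hQ
  have hP0 : 0 < P := by positivity
  have hQ0 : 0 < Q := by positivity
  have hθ0 : 0 ≤ (κ + 1) / κ := div_nonneg_of_nonpos h2.le h1.le
  have hθ : (κ + 1) / κ ≤ 1 := (div_le_one_of_neg h1).2 (by linarith)
  have e1 : 1 - (κ + 1) / κ = -(1 / κ) := by have := h1.ne; field_simp; ring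
  -- Hölder with exponent `(κ + 1) / κ`, applied to `(a c) ^ (1 / (κ + 1))` and `c`: the powers of
  -- `c` cancel and `a ^ (1 / κ)` remains.
  have key := weighted_holder_two ht hs (Real.rpow_pos_of_pos (mul_pos ha hc) (1 / (κ + 1)))
    (Real.rpow_pos_of_pos (mul_pos hb hd) (1 / (κ + 1))) hc hd hθ0 hθ
  have e2 (u v : ℝ) (hu : 0 < u) (hv : 0 < v) :
      ((u * v) ^ (1 / (κ + 1))) ^ ((κ + 1) / κ) * v ^ (-(1 / κ)) = u ^ (1 / κ) := by
    rw [← Real.rpow_mul (by positivity), show 1 / (κ + 1) * ((κ + 1) / κ) = 1 / κ by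
      have := h2.ne; field_simp, Real.mul_rpow hu.le hv.le, mul_assoc, ← Real.rpow_add hv,
      add_neg_cancel, Real.rpow_zero, mul_one]
  rw [e1, e2 a c ha hc, e2 b d hb hd, ← hP, ← hQ] at key
  have h := Real.rpow_le_rpow_of_nonpos hP0 key h1.le
  rw [Real.mul_rpow (by positivity) (by positivity), ← Real.rpow_mul hQ0.le,
    ← Real.rpow_mul (by positivity), div_mul_cancel₀ _ h1.ne, neg_mul, one_div_mul_cancel h1.ne,
    Real.rpow_neg_one, ← div_eq_mul_inv, div_le_iff₀ (by positivity)] at h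
  exact h

/-- The choice of `μ` in the theorem: with
`μ = lam * b ^ p / ((1 - lam) * a ^ p + lam * b ^ p)` Hölder's inequality between the coefficients
and `(a, b)` is an equality. -/
theorem exists_holder_equality {lam p a b : ℝ} (h0 : 0 < lam) (h1 : lam < 1) (hp : 1 ≤ p)
    (ha : 0 < a) (hb : 0 < b) :
    ∃ μ ∈ Ioo (0 : ℝ) 1, (1 - lam) ^ (1 / p) * (1 - μ) ^ invConj p * a +
      lam ^ (1 / p) * μ ^ invConj p * b = ((1 - lam) * a ^ p + lam * b ^ p) ^ (1 / p) := by
  have hp0 : 0 < p := by linarith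
  have hl : 0 < 1 - lam := by linarith
  set D := (1 - lam) * a ^ p + lam * b ^ p with hD
  have hD0 : 0 < D := by positivity
  have hA : 0 < (1 - lam) * a ^ p := by positivity
  have hB : 0 < lam * b ^ p := by positivity
  have key (l u : ℝ) (hl : 0 < l) (hu : 0 < u) :
      l ^ (1 / p) * (l * u ^ p / D) ^ invConj p * u = l * u ^ p / D ^ invConj p := by
    have hlu : 0 < l * u ^ p := by positivity
    have e : l ^ (1 / p) * u = (l * u ^ p) ^ (1 / p) := by
      rw [Real.mul_rpow hl.le (by positivity), ← Real.rpow_mul hu.le, mul_one_div_cancel hp0.ne',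
        Real.rpow_one]
    rw [Real.div_rpow hlu.le hD0.le, mul_right_comm, e, mul_div_assoc', ← Real.rpow_add hlu,
      invConj, add_sub_cancel, Real.rpow_one]
  refine ⟨lam * b ^ p / D, ⟨by positivity, (div_lt_one hD0).2 (by linarith)⟩, ?_⟩
  have e : 1 - lam * b ^ p / D = (1 - lam) * a ^ p / D := by
    field_simp
    linarith
  rw [e, key _ _ hl ha, key _ _ h0 hb, ← add_div, ← hD, div_eq_mul_inv, ← Real.rpow_neg hD0.le]
  nth_rewrite 1 [← Real.rpow_one D]
  rw [← Real.rpow_add hD0, invConj]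
  congr 1
  ring

theorem coefficients_add_le_one {lam p μ : ℝ} (h0 : 0 ≤ lam) (h1 : lam ≤ 1) (hp : 1 ≤ p)
    (hμ0 : 0 ≤ μ) (hμ1 : μ ≤ 1) :
    (1 - lam) ^ (1 / p) * (1 - μ) ^ invConj p + lam ^ (1 / p) * μ ^ invConj p ≤ 1 := by
  have hp0 : 0 < p := by linarith
  have hq : 0 ≤ 1 - 1 / p := sub_nonneg.2 ((div_le_one hp0).2 hp)
  have h2 := Real.geom_mean_le_arith_mean2_weighted (by positivity : 0 ≤ 1 / p) hq
    (sub_nonneg.2 h1) (sub_nonneg.2 hμ1) (by ring)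
  have h3 := Real.geom_mean_le_arith_mean2_weighted (by positivity : 0 ≤ 1 / p) hq h0 hμ0 (by ring)
  unfold invConj
  linarith

/-! ### From integrals to lattice sums -/

theorem lintegral_comp_floor {n : ℕ} (c : (Fin n → ℤ) → ℝ≥0∞) :
    ∫⁻ v : Fin n → ℝ, c (fun i => ⌊v i⌋) = ∑' z, c z := by
  have hm : Measurable fun (v : Fin n → ℝ) (i : Fin n) => ⌊v i⌋ :=
    measurable_pi_iff.2 fun i => Int.measurable_floor.comp (measurable_pi_apply i)
  rw [← lintegral_map (μ := volume) (f := c) (measurable_of_countable c) hm, lintegral_countable']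
  refine tsum_congr fun z => ?_
  have : (fun (v : Fin n → ℝ) (i : Fin n) => ⌊v i⌋) ⁻¹' {z} =
      univ.pi fun i => Ico (z i : ℝ) (z i + 1) := by
    ext v
    simp [funext_iff, Int.floor_eq_iff]
  rw [Measure.map_apply hm (measurableSet_singleton z), this, volume_pi_pi]
  simp

theorem tsum_inter_intLattice {n : ℕ} (S : Set (Fin n → ℝ)) (φ : (Fin n → ℝ) → ℝ≥0∞) :
    ∑' x : ↥(S ∩ intLattice n), φ x =
      ∑' z : Fin n → ℤ, S.indicator φ fun i => (z i : ℝ) := by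
  have hinj : Function.Injective fun (z : Fin n → ℤ) (i : Fin n) => (z i : ℝ) :=
    fun z w h => funext fun i => Int.cast_injective (congrFun h i)
  rw [tsum_subtype (S ∩ intLattice n) φ, ← hinj.tsum_eq]
  · refine tsum_congr fun z => ?_
    rw [inter_comm, ← indicator_indicator, indicator_of_mem]
    exact mem_range_self z
  · intro x hx
    exact (mem_of_indicator_ne_zero hx).2

theorem isBoundedOnBox_comp_floor {n : ℕ} {K : Set (Fin n → ℝ)} (hK : Bornology.IsBounded K)
    {φ : (Fin n → ℝ) → ℝ≥0∞} (hφ : ∑' x : ↥(K ∩ intLattice n), φ x ≠ ∞) :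
    IsBoundedOnBox fun v : Fin n → ℝ => K.indicator φ fun i => (⌊v i⌋ : ℝ) := by
  obtain ⟨R, hR⟩ := hK.exists_norm_le
  refine ⟨_, hφ, R + 1, fun v => ?_, fun v hv i => ?_⟩
  · rw [tsum_inter_intLattice]
    exact ENNReal.le_tsum fun i => ⌊v i⌋
  · have h1 : |(⌊v i⌋ : ℝ)| ≤ R :=
      (norm_le_pi_norm (fun i => (⌊v i⌋ : ℝ)) i).trans (hR _ (mem_of_indicator_ne_zero hv))
    have h2 := abs_le.1 h1
    have h3 := Int.floor_le (v i)
    have h4 := Int.lt_floor_add_one (v i)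
    exact ⟨by linarith, by linarith⟩

/-- If `m` is the integer part of `t x + s y`, then the weighted sum of the integer parts of `x` and
`y` lies in `m + (-1, 1)ⁿ`; this is where `t + s ≤ 1` enters. -/
theorem sub_floor_mem_openCube {n : ℕ} {t s : ℝ} (ht : 0 < t) (hs : 0 < s) (hts : t + s ≤ 1)
    (x y : Fin n → ℝ) :
    ((t • fun i => (⌊x i⌋ : ℝ)) + (s • fun i => (⌊y i⌋ : ℝ)) - fun i => (⌊(t • x + s • y) i⌋ : ℝ)) ∈
      openCube n := by
  intro i _
  have h1 := Int.floor_le (x i)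
  have h2 := Int.lt_floor_add_one (x i)
  have h3 := Int.floor_le (y i)
  have h4 := Int.lt_floor_add_one (y i)
  have h5 := Int.floor_le (t * x i + s * y i)
  have h6 := Int.lt_floor_add_one (t * x i + s * y i)
  have h7 := mul_le_mul_of_nonneg_left h1 ht.le
  have h8 := mul_lt_mul_of_pos_left h2 ht
  have h9 := mul_le_mul_of_nonneg_left h3 hs.le
  have h10 := mul_lt_mul_of_pos_left h4 hs
  simp only [Pi.sub_apply, Pi.add_apply, Pi.smul_apply, smul_eq_mul, mem_Ioo]
  constructor <;> nlinarith

/-- The passage from the Borell–Brascamp–Lieb inequality to lattice sums: the inequality is applied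
to the functions that take on each cube `z + [0, 1)ⁿ`, `z ∈ ℤⁿ`, the values `f z`, `g z` and
`diamond h z`. -/
theorem ofReal_mean_le_tsum_diamond {t s : ℝ} (ht : 0 < t) (hs : 0 < s) (hts : t + s ≤ 1)
    {Φ : ℕ → ℝ → ℝ → ℝ} {n : ℕ} (hΦ : ∀ k < n, IsMean (Φ k))
    (hstep : ∀ k < n, MeanStep t s (Φ k) (Φ (k + 1))) {K L S : Set (Fin n → ℝ)}
    (hK : Bornology.IsBounded K) (hL : Bornology.IsBounded L) {f g h : (Fin n → ℝ) → ℝ}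
    (hf : ∀ x, 0 ≤ f x) (hg : ∀ x, 0 ≤ g x) (hS : ∀ x ∈ K, ∀ y ∈ L, t • x + s • y ∈ S)
    (hyp : ∀ x ∈ K, ∀ y ∈ L, 0 < f x → 0 < g y → Φ 0 (f x) (g y) ≤ h (t • x + s • y))
    (hA : 0 < ∑' x : ↥(K ∩ intLattice n), f x) (hB : 0 < ∑' x : ↥(L ∩ intLattice n), g x) :
    ENNReal.ofReal (Φ n (∑' x : ↥(K ∩ intLattice n), f x) (∑' y : ↥(L ∩ intLattice n), g y)) ≤
      ∑' z : ↥((S + openCube n) ∩ intLattice n), diamond h z := by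
  have hsum (f : (Fin n → ℝ) → ℝ) (hf : ∀ x, 0 ≤ f x) {K : Set (Fin n → ℝ)}
      (hK : Bornology.IsBounded K) : ∑' x : ↥(K ∩ intLattice n), ENNReal.ofReal (f x) =
        ENNReal.ofReal (∑' x : ↥(K ∩ intLattice n), f x) := by
    have := (finite_inter_intLattice hK).to_subtype
    exact (ENNReal.ofReal_tsum_of_nonneg (f := fun x : ↥(K ∩ intLattice n) => f x) (fun x => hf x)
      Summable.of_finite).symm
  have hfA := hsum f hf hK
  have hgB := hsum g hg hL
  have hmeas (c : (Fin n → ℤ) → ℝ≥0∞) : Measurable fun v : Fin n → ℝ => c fun i => ⌊v i⌋ :=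
    (measurable_of_countable c).comp
      (measurable_pi_iff.2 fun i => Int.measurable_floor.comp (measurable_pi_apply i))
  have hint (S : Set (Fin n → ℝ)) (φ : (Fin n → ℝ) → ℝ≥0∞) :
      ∫⁻ v : Fin n → ℝ, S.indicator φ (fun i => (⌊v i⌋ : ℝ)) =
        ∑' x : ↥(S ∩ intLattice n), φ x := by
    rw [tsum_inter_intLattice]
    exact lintegral_comp_floor fun z => S.indicator φ fun i => (z i : ℝ)
  have main := ofReal_mean_le_lintegral ht hs hΦ hstep
    (F := fun v => K.indicator (fun x => ENNReal.ofReal (f x)) fun i => (⌊v i⌋ : ℝ))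
    (G := fun v => L.indicator (fun x => ENNReal.ofReal (g x)) fun i => (⌊v i⌋ : ℝ))
    (H := fun v => (S + openCube n).indicator (diamond h) fun i => (⌊v i⌋ : ℝ))
    (hmeas fun z => K.indicator _ fun i => (z i : ℝ))
    (hmeas fun z => L.indicator _ fun i => (z i : ℝ))
    (hmeas fun z => (S + openCube n).indicator _ fun i => (z i : ℝ))
    (isBoundedOnBox_comp_floor hK (by rw [hfA]; exact ENNReal.ofReal_ne_top))
    (isBoundedOnBox_comp_floor hL (by rw [hgB]; exact ENNReal.ofReal_ne_top))
    (by
      intro x y hx hy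
      have hxK := mem_of_indicator_ne_zero hx
      have hyL := mem_of_indicator_ne_zero hy
      rw [indicator_of_mem hxK] at hx ⊢
      rw [indicator_of_mem hyL] at hy ⊢
      have hu := sub_floor_mem_openCube ht hs hts x y
      set z : Fin n → ℝ := fun i => (⌊x i⌋ : ℝ)
      set w : Fin n → ℝ := fun i => (⌊y i⌋ : ℝ)
      set m : Fin n → ℝ := fun i => (⌊(t • x + s • y) i⌋ : ℝ)
      have hm : m ∈ S + openCube n := by
        refine ⟨t • z + s • w, hS z hxK w hyL, -(t • z + s • w - m), fun i hi => ?_, by simp⟩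
        have := hu i hi
        exact ⟨neg_lt_neg this.2, by simpa using neg_lt_neg this.1⟩
      rw [indicator_of_mem hm, ENNReal.toReal_ofReal (hf z), ENNReal.toReal_ofReal (hg w)]
      refine le_trans (ENNReal.ofReal_le_ofReal (hyp z hxK w hyL ?_ ?_)) ?_
      · simpa using hx
      · simpa using hy
      · rw [← add_sub_cancel m (t • z + s • w)]
        exact le_iSup₂ (f := fun u _ => ENNReal.ofReal (h (m + u))) _ hu)
    (by rw [hint, hfA]; exact (ENNReal.ofReal_pos.2 hA).ne')
    (by rw [hint, hgB]; exact (ENNReal.ofReal_pos.2 hB).ne')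
  rwa [hint, hint, hint, hfA, hgB, ENNReal.toReal_ofReal hA.le, ENNReal.toReal_ofReal hB.le] at main

/-! ### Power means and the choice of `μ` -/

theorem exists_powMean_eq {lam p κ A B : ℝ} (h0 : 0 < lam) (h1 : lam < 1) (hp : 1 ≤ p)
    (hκ : κ ≠ 0) (hA : 0 < A) (hB : 0 < B) :
    ∃ μ ∈ Ioo (0 : ℝ) 1,
      powMean ((1 - lam) ^ (1 / p) * (1 - μ) ^ invConj p) (lam ^ (1 / p) * μ ^ invConj p) κ A B =
        powMean (1 - lam) lam (κ / p) A B := by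
  obtain ⟨μ, hμ, h⟩ := exists_holder_equality h0 h1 hp (Real.rpow_pos_of_pos hA (1 / κ))
    (Real.rpow_pos_of_pos hB (1 / κ))
  have hl : 0 < 1 - lam := by linarith
  have hp0 : 0 < p := by linarith
  refine ⟨μ, hμ, ?_⟩
  unfold powMean
  rw [h, ← Real.rpow_mul hA.le, ← Real.rpow_mul hB.le, ← Real.rpow_mul (by positivity)]
  congr 1
  · congr 3 <;> field_simp
  · field_simp

theorem alphaSum_coe {r t s a b : ℝ} (ha : 0 < a) (hb : 0 < b) :
    alphaSum (r : EReal) t s a b = powMean t s (1 / r) a b := by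
  simp [alphaSum, powMean, ha.ne', hb.ne']

theorem alphaSum_top {t s a b : ℝ} (ha : 0 < a) (hb : 0 < b) (ht : 0 < t) (hs : 0 < s) :
    alphaSum ⊤ t s a b = max a b := by
  simp [alphaSum, ha.ne', hb.ne', ht.ne', hs.ne']

theorem alphaMean_coe {r lam a b : ℝ} (hr : r ≠ 0) (ha : 0 < a) (hb : 0 < b) :
    alphaMean (r : EReal) lam a b = powMean (1 - lam) lam (1 / r) a b := by
  rw [alphaMean, if_neg (by exact_mod_cast hr), alphaSum_coe ha hb]

theorem alphaMean_eq_zero {γ : EReal} {lam a b : ℝ} (h0 : 0 < lam) (h1 : lam < 1)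
    (hab : a = 0 ∨ b = 0) : alphaMean γ lam a b = 0 := by
  have h2 : 1 - lam ≠ 0 := by linarith
  rcases hab with rfl | rfl <;> simp [alphaMean, alphaSum, Real.zero_rpow, h2, h0.ne']

theorem theoremt (n : ℕ) (hn : 1 ≤ n) (lam : ℝ) (hlam : lam ∈ Ioo (0 : ℝ) 1) (p : ℝ) (hp : 1 ≤ p)
    (K L : Set (Fin n → ℝ)) (hK : K.Nonempty) (hL : L.Nonempty)
    (hKb : Bornology.IsBounded K) (hLb : Bornology.IsBounded L)
    (α : EReal) (hα : ((-1 / (n : ℝ) : ℝ) : EReal) ≤ α)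
    (f g h : (Fin n → ℝ) → ℝ)
    (hf : ∀ x, 0 ≤ f x) (hg : ∀ x, 0 ≤ g x) (hh : ∀ x, 0 ≤ h x)
    (hyp : α ≠ 0 → ∀ x ∈ K, ∀ y ∈ L, 0 < f x * g y → ∀ μ ∈ Icc (0 : ℝ) 1,
      alphaSum α ((1 - lam) ^ (1 / p) * (1 - μ) ^ invConj p) (lam ^ (1 / p) * μ ^ invConj p)
          (f x) (g y) ≤
        h (((1 - lam) ^ (1 / p) * (1 - μ) ^ invConj p) • x +
          (lam ^ (1 / p) * μ ^ invConj p) • y))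
    (hyp₀ : α = 0 → ∀ x ∈ K, ∀ y ∈ L, 0 < f x * g y →
      f x ^ (1 - lam) * g y ^ lam ≤ h ((1 - lam) • x + lam • y)) :
    ENNReal.ofReal (alphaMean (bblExponent n p α) lam
        (∑' x : ↥(K ∩ intLattice n), f x) (∑' y : ↥(L ∩ intLattice n), g y)) ≤
      ∑' z : ↥((pSum p (pSmul p (1 - lam) K) (pSmul p lam L) + openCube n) ∩ intLattice n),
        diamond h z := by
  obtain ⟨h0, h1⟩ := hlam
  have hl : 0 < 1 - lam := by linarith
  have hp0 : 0 < p := by linarith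
  have hn0 : (0 : ℝ) < n := by exact_mod_cast hn
  set A := ∑' x : ↥(K ∩ intLattice n), f x
  set B := ∑' y : ↥(L ∩ intLattice n), g y
  have hA' : 0 ≤ A := tsum_nonneg fun x => hf x
  have hB' : 0 ≤ B := tsum_nonneg fun y => hg y
  rcases hA'.eq_or_lt with hA | hA
  · simp [alphaMean_eq_zero h0 h1 (Or.inl hA.symm)]
  rcases hB'.eq_or_lt with hB | hB
  · simp [alphaMean_eq_zero h0 h1 (Or.inr hB.symm)]
  have coeff_pos (μ : ℝ) (hμ : μ ∈ Ioo (0 : ℝ) 1) :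
      0 < (1 - lam) ^ (1 / p) * (1 - μ) ^ invConj p ∧ 0 < lam ^ (1 / p) * μ ^ invConj p := by
    have h2 := hμ.1
    have h3 : 0 < 1 - μ := sub_pos.2 hμ.2
    constructor <;> positivity
  have core (μ : ℝ) (hμ : μ ∈ Ioo (0 : ℝ) 1) (Φ : ℕ → ℝ → ℝ → ℝ) (hΦ : ∀ k < n, IsMean (Φ k))
      (hstep : ∀ k < n, MeanStep ((1 - lam) ^ (1 / p) * (1 - μ) ^ invConj p)
        (lam ^ (1 / p) * μ ^ invConj p) (Φ k) (Φ (k + 1)))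
      (hyp : ∀ x ∈ K, ∀ y ∈ L, 0 < f x → 0 < g y → Φ 0 (f x) (g y) ≤
        h (((1 - lam) ^ (1 / p) * (1 - μ) ^ invConj p) • x +
          (lam ^ (1 / p) * μ ^ invConj p) • y)) :
      ENNReal.ofReal (Φ n A B) ≤
        ∑' z : ↥((pSum p (pSmul p (1 - lam) K) (pSmul p lam L) + openCube n) ∩ intLattice n),
          diamond h z := by
    refine ofReal_mean_le_tsum_diamond (coeff_pos μ hμ).1 (coeff_pos μ hμ).2
      (coefficients_add_le_one h0.le h1.le hp hμ.1.le hμ.2.le) hΦ hstep hKb hLb hf hg ?_ hyp hA hB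
    intro x hx y hy
    refine ⟨(1 - lam) ^ (1 / p) • x, ⟨x, hx, rfl⟩, lam ^ (1 / p) • y, ⟨y, hy, rfl⟩, μ,
      Ioo_subset_Icc_self hμ, ?_⟩
    simp [smul_smul, mul_comm]
  induction α using EReal.rec with
  | bot => simp at hα
  | top =>
    have hr : p / n ≠ 0 := by positivity
    rw [bblExponent, if_pos rfl, alphaMean_coe hr hA hB, one_div_div]
    obtain ⟨μ, hμ, h2⟩ := exists_powMean_eq h0 h1 hp hn0.ne' hA hB
    obtain ⟨ht, hs⟩ := coeff_pos μ hμ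
    have main := core μ hμ (fun k => if k = 0 then max else
        powMean ((1 - lam) ^ (1 / p) * (1 - μ) ^ invConj p) (lam ^ (1 / p) * μ ^ invConj p) k)
      (fun k _ => ?_) (fun k _ => ?_) (fun x hx y hy hfx hgy => ?_)
    · rwa [if_neg (by omega), h2] at main
    · split_ifs with hk
      · exact isMean_max
      · exact isMean_powMean ht hs (by exact_mod_cast hk)
    · rw [if_neg k.succ_ne_zero, Nat.cast_add_one]
      split_ifs with hk
      · simpa [hk] using meanStep_max ht hs
      · exact meanStep_powMean_of_pos ht hs (by exact_mod_cast Nat.pos_of_ne_zero hk)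
    · have := hyp (by simp) x hx y hy (mul_pos hfx hgy) μ (Ioo_subset_Icc_self hμ)
      rwa [alphaSum_top hfx hgy ht hs] at this
  | coe a =>
    have ha : -1 / (n : ℝ) ≤ a := by exact_mod_cast hα
    have hyp' (h2 : a ≠ 0) (μ : ℝ) (hμ : μ ∈ Ioo (0 : ℝ) 1) (x) (hx : x ∈ K) (y) (hy : y ∈ L)
        (hfx : 0 < f x) (hgy : 0 < g y) := alphaSum_coe (r := a) hfx hgy ▸
      hyp (by exact_mod_cast h2) x hx y hy (mul_pos hfx hgy) μ (Ioo_subset_Icc_self hμ)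
    rw [bblExponent, if_neg (EReal.coe_ne_top a)]
    rcases eq_or_ne a 0 with rfl | ha0
    · -- For `α = 0` only the value `μ = lam` is available; the coefficients are `1 - lam` and `lam`.
      have hcoe : ((0 : ℝ) : EReal) ≠ ((-1 / n : ℝ) : EReal) := by
        have : (0 : ℝ) ≠ -1 / n := (div_neg_of_neg_of_pos (by norm_num) hn0).ne'
        exact_mod_cast this
      have e (l : ℝ) (hl : 0 < l) : l ^ (1 / p) * l ^ invConj p = l := by
        rw [← Real.rpow_add hl, invConj, add_sub_cancel, Real.rpow_one]
      have main := core lam ⟨h0, h1⟩ (fun _ => geomMean (1 - lam) lam)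
      rw [e _ hl, e _ h0] at main
      rw [if_neg hcoe, EReal.toReal_coe, mul_zero, zero_div, EReal.coe_zero, alphaMean, if_pos rfl]
      exact main (fun _ _ => isMean_geomMean hl h0 (by ring))
          (fun _ _ => meanStep_geomMean hl h0 (by ring))
          (fun x hx y hy hfx hgy => hyp₀ rfl x hx y hy (mul_pos hfx hgy))
    rcases ha.eq_or_lt with rfl | ha
    · -- For `α = -1 / n` the chain `κ = -n, …, -1` ends with the minimum, for every `μ`.
      rw [if_pos rfl, alphaMean, if_neg (by simp)]
      have hμ : (1 / 2 : ℝ) ∈ Ioo (0 : ℝ) 1 := by norm_num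
      obtain ⟨ht, hs⟩ := coeff_pos _ hμ
      have main := core _ hμ (fun k => if k = n then min else
        powMean ((1 - lam) ^ (1 / p) * (1 - 1 / 2) ^ invConj p)
          (lam ^ (1 / p) * (1 / 2) ^ invConj p) (-n + k))
        (fun k hk => ?_) (fun k hk => ?_) (fun x hx y hy hfx hgy => ?_)
      · simpa [alphaSum, hA.ne', hB.ne', h0.ne', hl.ne'] using main
      · have : (k : ℝ) < n := by exact_mod_cast hk
        rw [if_neg hk.ne]
        exact isMean_powMean ht hs (by linarith)
      · rw [if_neg hk.ne]
        split_ifs with hk'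
        · rw [← hk', show -((k + 1 : ℕ) : ℝ) + k = -1 by push_cast; ring]
          exact meanStep_min ht hs
        · have : (k + 1 : ℝ) < n := by exact_mod_cast lt_of_le_of_ne hk hk'
          rw [Nat.cast_add_one, ← add_assoc]
          exact meanStep_powMean_of_lt_neg_one ht hs (by linarith)
      · rw [if_neg (by omega)]
        convert hyp' ha0 _ hμ x hx y hy hfx hgy using 2
        rw [one_div_div, Nat.cast_zero, add_zero, div_neg, div_one]
    · rw [if_neg (by exact_mod_cast ha.ne'), EReal.toReal_coe]
      have hden : 0 < n * a + 1 := by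
        rw [div_lt_iff₀ hn0] at ha
        linarith
      have hκ : 1 / a + n ≠ 0 := by
        rw [show 1 / a + n = (n * a + 1) / a by field_simp; ring]
        exact div_ne_zero hden.ne' ha0
      have hr : p * a / (n * a + 1) ≠ 0 := div_ne_zero (mul_ne_zero hp0.ne' ha0) hden.ne'
      obtain ⟨μ, hμ, h2⟩ := exists_powMean_eq h0 h1 hp hκ hA hB
      obtain ⟨ht, hs⟩ := coeff_pos μ hμ
      -- The chain `1 / α, 1 / α + 1, …, 1 / α + n` is positive, or its last term is negative and all
      -- others are below `-1`.  Between `-1` and `0` there is no step from `κ` to `κ + 1`.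
      have hsign : 0 < 1 / a ∨ 1 / a < -n := by
        rcases ha0.lt_or_gt with h3 | h3
        · right
          rw [div_lt_iff_of_neg h3]
          linarith
        · exact Or.inl (one_div_pos.2 h3)
      rw [alphaMean_coe hr hA hB, show 1 / (p * a / (n * a + 1)) = (1 / a + n) / p by
        field_simp; ring, ← h2]
      refine core μ hμ (fun k => powMean _ _ (1 / a + k)) (fun k hk => ?_) (fun k hk => ?_)
        (fun x hx y hy hfx hgy => ?_)
      · refine isMean_powMean ht hs ?_
        have h4 : (k : ℝ) < n := by exact_mod_cast hk
        rcases hsign with h3 | h3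
        · positivity
        · linarith
      · have h4 : (k + 1 : ℝ) ≤ n := by exact_mod_cast hk
        rw [Nat.cast_add_one, ← add_assoc]
        rcases hsign with h3 | h3
        · exact meanStep_powMean_of_pos ht hs (by positivity)
        · exact meanStep_powMean_of_lt_neg_one ht hs (by linarith)
      · simpa using hyp' ha0 μ hμ x hx y hy hfx hgy
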